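/- Let $(V,g)$ be a $4$-dimensional Euclidean vector space and $S^3=\{x\in V: g(x,x)=1\}$ its unit sphere with the induced (round) metric, also denoted $g$, and Levi-Civita connection $\nabla$. Symmetric bilinear forms and symmetric endomorphisms are identified by means of $g$. A *special conformal Killing tensor* on $S^3$ is a smooth symmetric tensor field $L_{\alpha\beta}$ with $\nabla_\gamma L_{\alpha\beta}=\lambda_\alpha g_{\beta\gamma}+\lambda_\beta g_{\alpha\gamma}$, where $\lambda=\tfrac12\nabla\operatorname{tr}L$. A *Killing tensor* is a smooth symmetric tensor field $K_{\alpha\beta}$ with $\nabla_{(\gamma}K_{\alpha\beta)}=0$. It is *integrable* if $N^\delta{}_{[\beta\gamma}g_{\alpha]\delta}=0$, $N^\delta{}_{[\beta\gamma}K_{\alpha]\delta}=0$ and $N^\delta{}_{[\beta\gamma}K_{\alpha]\varepsilon}K^\varepsilon{}_\delta=0$, where $N^\alpha{}_{\beta\gamma}=K^\alpha{}_\delta\nabla_{[\gamma}K^\delta{}_{\beta]}+\nabla_\delta K^\alpha{}_{[\gamma}K^\delta{}_{\beta]}$ is the Nijenhuis torsion of $K$. A *Stäckel system* on $S^3$ is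 a $3$-dimensional vector space of integrable Killing tensors which commute mutually as endomorphisms of each tangent space. The special conformal Killing tensors $L$ on $S^3$ are exactly the restrictions to $S^3$ (that is, $L_x=\hat L|_{T_xS^3\times T_xS^3}$ for all $x\in S^3$) of constant symmetric bilinear forms $\hat L$ on $V$. Let $L$ be such a tensor, the restriction of $\hat L$. Then its Benenti system, where $\operatorname{Adj}$ denotes the adjugate (the transpose of the cofactor matrix), is of the form $$K(\lambda)=\operatorname{Adj}(L-\lambda g)=K_2\lambda^2+K_1\lambda+K_0\qquad(\lambda\in\mathbb R)$$ with tensor fields $K_0,K_1,K_2$ on $S^3$, and the linear span of $K_0,K_1,K_2$ is a Stäckel system if and only if $\hat L$ has no triple eigenvalue, i.e. no eigenvalue of multiplicity at least three. -/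

import Mathlib

open scoped InnerProductSpace ContDiff

noncomputable section

namespace RoundSphere

variable {V : Type*} [NormedAddCommGroup V] [InnerProductSpace ℝ V]

/-- The unit sphere `{x | g(x,x) = 1}` of the Euclidean vector space `V`. -/
abbrev Sph (V : Type*) [NormedAddCommGroup V] [InnerProductSpace ℝ V] : Set V :=
  Metric.sphere (0 : V) 1

/-- The tangent space `T_x S = x^⊥` of the unit sphere at `x`, with the inner product of `V`
(the round metric). -/
abbrev Tan (x : Sph V) : Submodule ℝ V := (Submodule.span ℝ {(x : V)})ᗮ

/-- Orthogonal projection `V → T_x S`. -/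
abbrev tanProj (x : Sph V) : V →L[ℝ] Tan x := (Tan x).orthogonalProjectionOnto

/-- (Not necessarily smooth) tangent vector fields on the unit sphere. -/
abbrev VectorField (V : Type*) [NormedAddCommGroup V] [InnerProductSpace ℝ V] : Type _ :=
  ∀ x : Sph V, Tan x

/-- (Not necessarily smooth) fields of endomorphisms of the tangent spaces of the unit sphere.
The bilinear form corresponding to `K` is `K_x(v,w) = ⟪K x v, w⟫`; in particular, the metric
corresponds to the field `1` of identity maps. -/
abbrev EndField (V : Type*) [NormedAddCommGroup V] [InnerProductSpace ℝ V] : Type _ :=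
  ∀ x : Sph V, Module.End ℝ (Tan x)

open Classical in
/-- Extension of a function on the unit sphere to `V \ {0}`, constant along rays (with the
irrelevant value `0` at the origin). -/
def radialExt {E : Type*} [Zero E] (f : Sph V → E) (y : V) : E :=
  if h : y = 0 then 0
  else f ⟨‖y‖⁻¹ • y, by
    rw [mem_sphere_zero_iff_norm, norm_smul, norm_inv, norm_norm,
      inv_mul_cancel₀ (norm_ne_zero_iff.mpr h)]⟩

/-- The derivative `D_u f` of a function on the unit sphere in a tangent direction `u`. -/
def dirDeriv {E : Type*} [NormedAddCommGroup E] [NormedSpace ℝ E]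
    (f : Sph V → E) (x : Sph V) (u : Tan x) : E :=
  fderiv ℝ (radialExt f) (x : V) (u : V)

/-- The Levi-Civita connection of the unit sphere: `∇_u X` is the tangential part of the
derivative of `X`, regarded as a `V`-valued function, in the direction `u`. -/
def covDeriv (X : VectorField V) (x : Sph V) (u : Tan x) : Tan x :=
  tanProj x (dirDeriv (fun z => (X z : V)) x u)

/-- The tangential part of a constant vector field on `V`. It extends the tangent vector `v` at `x`
to a smooth tangent vector field on the sphere. -/
def tanField (v : V) : VectorField V := fun z => tanProj z v

/-- The covariant derivative `(∇_u K) v` of an endomorphism field, by the Leibniz rule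
`(∇_u K)(Y) = ∇_u (K Y) - K (∇_u Y)` for a vector field `Y` extending `v`. -/
def covDerivEnd (K : EndField V) (x : Sph V) (u v : Tan x) : Tan x :=
  covDeriv (fun z => K z (tanField (v : V) z)) x u - K x (covDeriv (tanField (v : V)) x u)

/-- Smoothness of an endomorphism field on the sphere, tested on the smooth vector fields
`tanField v`, which span every tangent space. -/
def IsSmooth (K : EndField V) : Prop :=
  ∀ v : V, ContDiffOn ℝ ∞ (radialExt fun z => (K z (tanField v z) : V)) {0}ᶜ

/-- Smooth symmetric tensor fields on the unit sphere. -/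
structure IsSymmTensor (K : EndField V) : Prop where
  smooth : IsSmooth K
  symm : ∀ x, (K x).IsSymmetric

/-- Killing tensors: symmetric tensor fields with `∇_(γ K_αβ) = 0`. -/
structure IsKillingTensor (K : EndField V) : Prop extends IsSymmTensor K where
  killing : ∀ (x : Sph V) (u v w : Tan x),
    ⟪covDerivEnd K x u v, w⟫_ℝ + ⟪covDerivEnd K x v w, u⟫_ℝ + ⟪covDerivEnd K x w u, v⟫_ℝ = 0

/-- The Nijenhuis torsion
`N^α_βγ = K^α_δ ∇_[γ K^δ_β] + ∇_δ K^α_[γ K^δ_β]`, as the vector `N(b,c)`. -/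
def nijenhuis (K : EndField V) (x : Sph V) (b c : Tan x) : Tan x :=
  (1 / 2 : ℝ) • (K x (covDerivEnd K x c b - covDerivEnd K x b c)
    + (covDerivEnd K x (K x b) c - covDerivEnd K x (K x c) b))

/-- Complete antisymmetrisation of a function of three vectors. -/
def alt {T : Type*} (F : T → T → T → ℝ) (a b c : T) : ℝ :=
  (1 / 6 : ℝ) * (F a b c - F a c b + F b c a - F b a c + F c a b - F c b a)

/-- Integrability, i.e. the Nijenhuis integrability conditions: the antisymmetrisations of
`N^δ_βγ g_αδ`, of `N^δ_βγ K_αδ` and of `N^δ_βγ K_αε K^ε_δ` over `α, β, γ` vanish. -/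
def IsIntegrable (K : EndField V) : Prop :=
  ∀ (x : Sph V) (a b c : Tan x),
    alt (fun a b c => ⟪a, nijenhuis K x b c⟫_ℝ) a b c = 0 ∧
    alt (fun a b c => ⟪a, K x (nijenhuis K x b c)⟫_ℝ) a b c = 0 ∧
    alt (fun a b c => ⟪a, K x (K x (nijenhuis K x b c))⟫_ℝ) a b c = 0

/-- Stäckel systems: for the unit sphere of dimension `n = dim V - 1`, these are the `n`-dimensional
vector spaces of mutually (pointwise, as endomorphisms) commuting integrable Killing tensors. -/
structure IsStackelSystem (W : Submodule ℝ (EndField V)) : Prop where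
  dim : Module.finrank ℝ W + 1 = Module.finrank ℝ V
  killing : ∀ K ∈ W, IsKillingTensor K
  integrable : ∀ K ∈ W, IsIntegrable K
  commute : ∀ K ∈ W, ∀ K' ∈ W, ∀ x, Commute (K x) (K' x)

/-- Special conformal Killing tensors: symmetric tensor fields satisfying the Sinjukov equation
`∇_γ L_αβ = λ_α g_βγ + λ_β g_αγ` with `λ = (1/2) ∇ tr L`. -/
structure IsSpecialConformalKilling (L : EndField V) : Prop extends IsSymmTensor L where
  sinjukov : ∀ (x : Sph V) (u v w : Tan x),
    ⟪covDerivEnd L x u v, w⟫_ℝ =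
      (1 / 2 * dirDeriv (fun z => LinearMap.trace ℝ (Tan z) (L z)) x v) * ⟪w, u⟫_ℝ
      + (1 / 2 * dirDeriv (fun z => LinearMap.trace ℝ (Tan z) (L z)) x w) * ⟪v, u⟫_ℝ

/-- The restriction to the unit sphere of a constant tensor on `V`: the bilinear form
`(v,w) ↦ ⟪A v, w⟫` on `V` is restricted to each tangent space. -/
def restrict (A : Module.End ℝ V) : EndField V :=
  fun x => (tanProj x : V →ₗ[ℝ] Tan x) ∘ₗ A ∘ₗ (Tan x).subtype

/-- The adjugate (transpose of the cofactor matrix) of an endomorphism of a finite-dimensional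
vector space, computed in a basis. -/
def endAdj {T : Type*} [AddCommGroup T] [Module ℝ T] [FiniteDimensional ℝ T]
    (A : Module.End ℝ T) : Module.End ℝ T :=
  Matrix.toLin (Module.finBasis ℝ T) (Module.finBasis ℝ T)
    (LinearMap.toMatrix (Module.finBasis ℝ T) (Module.finBasis ℝ T) A).adjugate

/-- The adjugate does not depend on the basis. -/
theorem endAdj_eq {T ι : Type*} [AddCommGroup T] [Module ℝ T] [FiniteDimensional ℝ T]
    [Fintype ι] [DecidableEq ι] (b : Module.Basis ι ℝ T) (A : Module.End ℝ T) :
    endAdj A = Matrix.toLin b b (LinearMap.toMatrix b b A).adjugate := by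
  classical
  set f := Module.finBasis ℝ T with hf
  let e := f.indexEquiv b
  have hre : ∀ M : Matrix (Fin (Module.finrank ℝ T)) (Fin (Module.finrank ℝ T)) ℝ,
      Matrix.toLin (f.reindex e) (f.reindex e) (Matrix.reindex e e M) = Matrix.toLin f f M := by
    intro M
    refine f.ext fun i => ?_
    have h : f i = (f.reindex e) (e i) := by simp
    rw [Matrix.toLin_self]
    conv_lhs => rw [h]
    rw [Matrix.toLin_self]
    simp [← e.sum_comp]
  have hA : LinearMap.toMatrix (f.reindex e) (f.reindex e) A =
      Matrix.reindex e e (LinearMap.toMatrix f f A) := by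
    apply (Matrix.toLin (f.reindex e) (f.reindex e)).injective
    rw [hre]; simp
  have h1 : endAdj A = Matrix.toLin (f.reindex e) (f.reindex e)
      (LinearMap.toMatrix (f.reindex e) (f.reindex e) A).adjugate := by
    rw [hA, Matrix.adjugate_reindex, hre]; rfl
  rw [h1]
  generalize f.reindex e = c
  apply (LinearMap.toMatrix b b).injective
  rw [LinearMap.toMatrix_toLin, ← basis_toMatrix_mul_linearMap_toMatrix_mul_basis_toMatrix b c b c,
    LinearMap.toMatrix_toLin, ← basis_toMatrix_mul_linearMap_toMatrix_mul_basis_toMatrix c b c b A,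
    Matrix.adjugate_mul_distrib, Matrix.adjugate_mul_distrib]
  have hPQ : b.toMatrix c * c.toMatrix b = 1 := b.toMatrix_mul_toMatrix_flip c
  have hQP : c.toMatrix b * b.toMatrix c = 1 := c.toMatrix_mul_toMatrix_flip b
  have e1 : Matrix.adjugate (b.toMatrix c) = (b.toMatrix c).det • c.toMatrix b := by
    rw [← mul_one (Matrix.adjugate (b.toMatrix c)), ← hPQ, ← mul_assoc, Matrix.adjugate_mul]
    simp
  have e2 : Matrix.adjugate (c.toMatrix b) = (c.toMatrix b).det • b.toMatrix c := by
    rw [← mul_one (Matrix.adjugate (c.toMatrix b)), ← hQP, ← mul_assoc, Matrix.adjugate_mul]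
    simp
  have hd : (c.toMatrix b).det * (b.toMatrix c).det = 1 := by
    rw [← Matrix.det_mul, hQP, Matrix.det_one]
  rw [e1, e2]
  simp only [Matrix.smul_mul, Matrix.mul_smul, smul_smul]
  rw [hd, one_smul]
  simp only [← mul_assoc]
  rw [hPQ, one_mul, mul_assoc, hPQ, mul_one]

/-- The Benenti system `K(t) = Adj (L - t g)` of `L`. -/
def benenti [FiniteDimensional ℝ V] (L : EndField V) (t : ℝ) : EndField V :=
  fun x => endAdj (L x - t • 1)

end RoundSphere

end

/-! Tensor fields on the sphere are handled as tangential projections of endomorphism fields `F` on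
`V`, so covariant derivatives become ambient derivatives plus correction terms
(`covDerivEnd_projField`).

Restrictions versus the Sinjukov equation: for constant `A` the correction terms have exactly the
Sinjukov form, with `λ = -P(Ax)`. Conversely, the equation makes the derivative of `L(e,e)` vanish
along the great sphere orthogonal to `e`. This sphere is connected, so `L(e,e)` is constant on it.
By polarization `L_x(v,w)` is independent of `x ⊥ v, w`. Any three vectors of `V` have a common unit
normal, so these values form one bilinear form on `V`.

Benenti system: tangent spaces have dimension 3, where `Adj B = B² - (tr B) B + e₂(B)`. Hence every
combination `α K₂ + β K₁ + γ K₀` is the projection of an explicit polynomial field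
(`benentiAmbient`) and, pointwise, a polynomial in `L`. Commutation is then immediate, and the
Killing equation is a cancellation. For integrability, take an eigenbasis of `L_x`: the components
of `∇K` with three distinct indices vanish, and only these enter the antisymmetrised conditions.

So the span is a Stäckel system iff its dimension is 3. A triple eigenvalue `μ` makes `L - μg` of
rank at most one everywhere, whence `K(μ) = 0` is a linear relation. Without one, evaluating a
relation at eigenvectors of `A` gives `α - β(aᵢ + aⱼ) + γ aᵢaⱼ = 0` for all `i ≠ j`, which forces `α
= β = γ = 0`. -/

noncomputable section

namespace RoundSphere

variable {V : Type*} [NormedAddCommGroup V] [InnerProductSpace ℝ V]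

/-! ### Differential calculus on the sphere through ambient functions -/

section Calculus

theorem norm_coe_sph (x : Sph V) : ‖(x : V)‖ = 1 := mem_sphere_zero_iff_norm.mp x.2

theorem coe_sph_ne_zero (x : Sph V) : (x : V) ≠ 0 := by
  rw [← norm_ne_zero_iff, norm_coe_sph]; exact one_ne_zero

theorem inner_sph_tan (x : Sph V) (u : Tan x) : ⟪(x : V), (u : V)⟫_ℝ = 0 :=
  Submodule.mem_orthogonal_singleton_iff_inner_right.mp u.2

theorem inner_tan_sph (x : Sph V) (u : Tan x) : ⟪(u : V), (x : V)⟫_ℝ = 0 := by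
  rw [real_inner_comm, inner_sph_tan]

theorem coe_tanProj (x : Sph V) (v : V) : (tanProj x v : V) = v - ⟪(x : V), v⟫_ℝ • (x : V) := by
  rw [Submodule.coe_orthogonalProjectionOnto_apply, Submodule.starProjection_orthogonal_val,
    Submodule.starProjection_unit_singleton ℝ (norm_coe_sph x)]

theorem tanProj_coe (x : Sph V) (v : Tan x) : tanProj x (v : V) = v :=
  Submodule.orthogonalProjectionOnto_mem_subspace_eq_self v

theorem tanProj_self (x : Sph V) : tanProj x (x : V) = 0 := by
  ext; rw [coe_tanProj]; simp

theorem inner_tanProj_left (x : Sph V) (v : V) (w : Tan x) :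
    ⟪tanProj x v, w⟫_ℝ = ⟪v, (w : V)⟫_ℝ :=
  Submodule.inner_orthogonalProjectionOnto_eq_of_mem_right w v

theorem inner_tanProj_right (x : Sph V) (v : Tan x) (w : V) :
    ⟪v, tanProj x w⟫_ℝ = ⟪(v : V), w⟫_ℝ :=
  Submodule.inner_orthogonalProjectionOnto_eq_of_mem_left v w

theorem radialExt_coe {E : Type*} [Zero E] (f : Sph V → E) (x : Sph V) : radialExt f x = f x := by
  rw [radialExt, dif_neg (coe_sph_ne_zero x)]
  congr 1
  ext
  simp

theorem radialExt_smul {E : Type*} [Zero E] (f : Sph V → E) {c : ℝ} (hc : 0 < c) (y : V) :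
    radialExt f (c • y) = radialExt f y := by
  by_cases hy : y = 0
  · simp [hy]
  · have hcy : c • y ≠ 0 := smul_ne_zero hc.ne' hy
    rw [radialExt, radialExt, dif_neg hcy, dif_neg hy]
    congr 1
    ext
    simp only [norm_smul, Real.norm_eq_abs, abs_of_pos hc, smul_smul, mul_inv]
    congr 1
    field_simp

theorem radialExt_eqOn {E : Type*} [Zero E] {f : Sph V → E} {G : V → E} (h : ∀ z : Sph V, f z = G z) :
    Set.EqOn (radialExt f) (fun y => G (‖y‖⁻¹ • y)) {0}ᶜ := by
  intro y hy
  have hy' : y ≠ 0 := hy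
  rw [radialExt, dif_neg hy', h]

variable {E : Type*} [NormedAddCommGroup E] [NormedSpace ℝ E]

theorem contDiffOn_normalize : ContDiffOn ℝ ∞ (fun y : V => ‖y‖⁻¹ • y) {0}ᶜ := by
  intro y hy
  have hy' : y ≠ 0 := hy
  have h1 : ContDiffAt ℝ ∞ (fun y : V => ‖y‖) y := contDiffAt_norm ℝ hy'
  exact ((h1.inv (norm_ne_zero_iff.mpr hy')).smul contDiffAt_id).contDiffWithinAt

theorem contDiffOn_radialExt {f : Sph V → E} {G : V → E} (h : ∀ z : Sph V, f z = G z)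
    (hG : ContDiff ℝ ∞ G) : ContDiffOn ℝ ∞ (radialExt f) {0}ᶜ :=
  (hG.comp_contDiffOn contDiffOn_normalize).congr (radialExt_eqOn h)

theorem fderiv_norm_of_inner_eq_zero (x u : V) (hx : x ≠ 0) (hu : ⟪x, u⟫_ℝ = 0) :
    fderiv ℝ (fun y : V => ‖y‖) x u = 0 := by
  have h1 : HasFDerivAt (fun y : V => ‖y‖) (fderiv ℝ (fun y : V => ‖y‖) x) x :=
    ((contDiffAt_norm ℝ hx (n := 1)).differentiableAt one_ne_zero).hasFDerivAt
  have h2 := h1.pow 2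
  have h3 := (hasStrictFDerivAt_norm_sq x).hasFDerivAt
  have h4 := congrArg (fun T : V →L[ℝ] ℝ => T u) (h2.unique h3)
  simpa [hu, hx] using h4

theorem fderiv_normalize_apply (x : Sph V) (u : Tan x) :
    DifferentiableAt ℝ (fun y : V => ‖y‖⁻¹ • y) (x : V) ∧
      fderiv ℝ (fun y : V => ‖y‖⁻¹ • y) (x : V) (u : V) = u := by
  have hx := coe_sph_ne_zero x
  have h1 : DifferentiableAt ℝ (fun y : V => ‖y‖) (x : V) :=
    (contDiffAt_norm ℝ hx (n := 1)).differentiableAt one_ne_zero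
  have h2 : DifferentiableAt ℝ (fun y : V => ‖y‖⁻¹) (x : V) := h1.inv (norm_ne_zero_iff.mpr hx)
  have h3 : DifferentiableAt ℝ (fun y : V => y) (x : V) := differentiableAt_id
  refine ⟨h2.smul h3, ?_⟩
  have h4 : HasFDerivAt (fun y : V => ‖y‖⁻¹) _ (x : V) :=
    (hasDerivAt_inv (norm_ne_zero_iff.mpr hx)).comp_hasFDerivAt (x : V) h1.hasFDerivAt
  have h5 := h4.smul (hasFDerivAt_id (x : V))
  have h6 := h5.fderiv
  simp only [id] at h6
  rw [show fderiv ℝ (fun y : V => ‖y‖⁻¹ • y) (x : V) = _ from h6]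
  simp [fderiv_norm_of_inner_eq_zero _ _ hx (inner_sph_tan x u)]

/-- Normalisation `y ↦ y/‖y‖` fixes `x` and its derivative there is the identity on tangent vectors.
Hence any ambient function that agrees with `f` on the sphere computes the derivative, homogeneous
or not. -/
theorem dirDeriv_eq_fderiv {f : Sph V → E} {G : V → E} (h : ∀ z : Sph V, f z = G z)
    (x : Sph V) (hG : DifferentiableAt ℝ G (x : V)) (u : Tan x) :
    dirDeriv f x u = fderiv ℝ G (x : V) (u : V) := by
  obtain ⟨hd, hn⟩ := fderiv_normalize_apply x u
  have hx1 : ‖(x : V)‖⁻¹ • (x : V) = x := by simp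
  have heq : radialExt f =ᶠ[nhds (x : V)] G ∘ fun y => ‖y‖⁻¹ • y :=
    (radialExt_eqOn h).eventuallyEq_of_mem (isOpen_compl_singleton.mem_nhds (coe_sph_ne_zero x))
  rw [dirDeriv, heq.fderiv_eq, fderiv_comp _ (by simpa only [hx1] using hG) hd,
    ContinuousLinearMap.comp_apply, hn, hx1]

end Calculus

/-! ### Covariant derivatives of projected ambient fields -/

section ProjectedFields

/-- The field of endomorphisms `v ↦ P (F x v)` of the tangent spaces, `P` being the orthogonal
projection, obtained from a field `F` of endomorphisms of the ambient space. -/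
def projField (F : V → V →L[ℝ] V) : EndField V :=
  fun x => (tanProj x : V →ₗ[ℝ] Tan x) ∘ₗ (F x : V →ₗ[ℝ] V) ∘ₗ (Tan x).subtype

theorem projField_apply (F : V → V →L[ℝ] V) (x : Sph V) (v : Tan x) :
    projField F x v = tanProj x (F x v) := rfl

theorem inner_projField (F : V → V →L[ℝ] V) (x : Sph V) (v w : Tan x) :
    ⟪projField F x v, w⟫_ℝ = ⟪F x v, (w : V)⟫_ℝ := inner_tanProj_left x _ w

/-- The ambient expression of the projection onto the tangent space at `z`. -/
def ambientProj (v z : V) : V := v - ⟪z, v⟫_ℝ • z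

theorem coe_tanField (v : V) (z : Sph V) : (tanField v z : V) = ambientProj v z := coe_tanProj z v

theorem ambientProj_tan (x : Sph V) (v : Tan x) : ambientProj (v : V) (x : V) = v := by
  simp [ambientProj, inner_sph_tan]

theorem hasFDerivAt_ambientProj (v z : V) :
    HasFDerivAt (ambientProj v)
      (-(⟪z, v⟫_ℝ • ContinuousLinearMap.id ℝ V + (innerSL ℝ v).smulRight z)) z := by
  have h1 : HasFDerivAt (fun z : V => ⟪z, v⟫_ℝ) (innerSL ℝ v) z := by
    have := (innerSL ℝ v).hasFDerivAt (x := z)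
    exact this.congr_of_eventuallyEq (Filter.Eventually.of_forall fun y => by
      simp [real_inner_comm])
  have h2 := (h1.smul (hasFDerivAt_id z)).const_sub v
  exact h2

/-- The derivative of `v - ⟪z, v⟫ z` at `x` along `u` is `-⟪x, v⟫ u - ⟪u, v⟫ x`. The first term
vanishes because `v` is tangent at `x`, the second is normal. The correction term of the Leibniz
rule therefore drops out. -/
theorem covDeriv_tanField (x : Sph V) (u v : Tan x) : covDeriv (tanField (v : V)) x u = 0 := by
  have h := hasFDerivAt_ambientProj (v : V) (x : V)
  rw [covDeriv, dirDeriv_eq_fderiv (coe_tanField (v : V)) x h.differentiableAt, h.fderiv]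
  simp [inner_sph_tan, tanProj_self]

theorem contDiff_ambientProj (v : V) : ContDiff ℝ ∞ (ambientProj v) :=
  contDiff_const.sub ((contDiff_id.inner ℝ contDiff_const).smul contDiff_id)

/-- The ambient expression of `z ↦ P (F z (P v))`. -/
def ambientField (F : V → V →L[ℝ] V) (v z : V) : V :=
  F z (ambientProj v z) - ⟪z, F z (ambientProj v z)⟫_ℝ • z

theorem coe_projField_tanField (F : V → V →L[ℝ] V) (v : V) (z : Sph V) :
    (projField F z (tanField v z) : V) = ambientField F v z := by
  rw [projField_apply, coe_tanProj, coe_tanField]; rfl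

theorem isSmooth_projField {F : V → V →L[ℝ] V} (hF : ContDiff ℝ ∞ F) :
    IsSmooth (projField F) := fun v => by
  refine contDiffOn_radialExt (coe_projField_tanField F v) ?_
  have h : ContDiff ℝ ∞ fun z => F z (ambientProj v z) := hF.clm_apply (contDiff_ambientProj v)
  exact h.sub ((contDiff_id.inner ℝ h).smul contDiff_id)

/-- The two terms besides `F'` come from differentiating the projections on the left and on the
right of `F`. -/
theorem covDerivEnd_projField {F : V → V →L[ℝ] V} {F' : V →L[ℝ] V →L[ℝ] V} {x : Sph V}
    (hF : HasFDerivAt F F' (x : V)) (u v : Tan x) :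
    covDerivEnd (projField F) x u v =
      tanProj x (F' u v) - ⟪(x : V), F x v⟫_ℝ • u - ⟪(u : V), (v : V)⟫_ℝ • tanProj x (F x x) := by
  have h1 := hF.clm_apply (hasFDerivAt_ambientProj (v : V) (x : V))
  have h2 := h1.sub (((hasFDerivAt_id (x : V)).inner ℝ h1).smul (hasFDerivAt_id (x : V)))
  rw [covDerivEnd, covDeriv_tanField, map_zero, sub_zero, covDeriv,
    dirDeriv_eq_fderiv (coe_projField_tanField F v) x (G := ambientField F v)
      h2.differentiableAt, show fderiv ℝ (ambientField F v) (x : V) = _ from h2.fderiv]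
  simp [inner_sph_tan, tanProj_self, ambientProj_tan, real_inner_comm]
  abel

end ProjectedFields

/-! ### Ambient form of the Benenti fields -/

section BenentiFields

variable (V) in
/-- The inner product as a continuous bilinear map. -/
def innerL : V →L[ℝ] V →L[ℝ] ℝ :=
  LinearMap.mkContinuous₂ (innerₗ V) 1 fun x y => by
    simpa using norm_inner_le_norm (𝕜 := ℝ) x y

theorem innerL_apply (v w : V) : innerL V v w = ⟪v, w⟫_ℝ := rfl

/-- The rank one endomorphism `v ↦ ⟪a, v⟫ a`. -/
def rankOneSq (a : V) : V →L[ℝ] V := ContinuousLinearMap.smulRightL ℝ V V (innerL V a) a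

theorem rankOneSq_apply (a v : V) : rankOneSq a v = ⟪a, v⟫_ℝ • a := rfl

/-- The coefficient of the metric in `benentiAmbient`. -/
def benentiScalar (A : V →L[ℝ] V) (τ e α β γ : ℝ) (z : V) : ℝ :=
  α + β * (⟪A z, z⟫_ℝ - τ) + γ * (e - τ * ⟪A z, z⟫_ℝ + ⟪A z, A z⟫_ℝ)

/-- Ambient expression of the combination `α K₂ + β K₁ + γ K₀` of the coefficients of the Benenti
system of the restriction of `A`, where `τ` and `e` stand for the first and second elementary
symmetric functions of the eigenvalues of `A`. -/
def benentiAmbient (A : V →L[ℝ] V) (τ e α β γ : ℝ) (z : V) : V →L[ℝ] V :=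
  γ • (A ∘L A) - γ • rankOneSq (A z) + (β + γ * (⟪A z, z⟫_ℝ - τ)) • A
    + benentiScalar A τ e α β γ z • ContinuousLinearMap.id ℝ V

variable (A : V →L[ℝ] V) (τ e α β γ : ℝ)

theorem benentiAmbient_apply (z v : V) :
    benentiAmbient A τ e α β γ z v = γ • A (A v) - γ • ⟪A z, v⟫_ℝ • A z
      + (β + γ * (⟪A z, z⟫_ℝ - τ)) • A v + benentiScalar A τ e α β γ z • v := rfl

theorem contDiff_benentiAmbient : ContDiff ℝ ∞ (benentiAmbient A τ e α β γ) := by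
  have hA : ContDiff ℝ ∞ A := A.contDiff
  have h1 : ContDiff ℝ ∞ fun z => ⟪A z, z⟫_ℝ := hA.inner ℝ contDiff_id
  have h2 : ContDiff ℝ ∞ fun z => ⟪A z, A z⟫_ℝ := hA.inner ℝ hA
  have h3 : ContDiff ℝ ∞ fun z => rankOneSq (A z) :=
    ((ContinuousLinearMap.smulRightL ℝ V V ∘L innerL V ∘L A).contDiff).clm_apply hA
  have h4 : ContDiff ℝ ∞ (benentiScalar A τ e α β γ) := by
    unfold benentiScalar
    fun_prop
  have h5 : ContDiff ℝ ∞ fun z => γ • rankOneSq (A z) := h3.const_smul γ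
  have h8 : ContDiff ℝ ∞ fun z => β + γ * (⟪A z, z⟫_ℝ - τ) := by fun_prop
  have h6 : ContDiff ℝ ∞ fun z => (β + γ * (⟪A z, z⟫_ℝ - τ)) • A :=
    h8.smul contDiff_const
  have h7 : ContDiff ℝ ∞ fun z => benentiScalar A τ e α β γ z • ContinuousLinearMap.id ℝ V :=
    h4.smul contDiff_const
  unfold benentiAmbient
  exact ((contDiff_const.sub h5).add h6).add h7

/-- Only the values of the derivative matter later, so the map itself stays existentially
quantified. -/
theorem exists_hasFDerivAt_benentiAmbient (hA : ∀ v w, ⟪A v, w⟫_ℝ = ⟪v, A w⟫_ℝ) (x : V) :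
    ∃ F' : V →L[ℝ] V →L[ℝ] V, HasFDerivAt (benentiAmbient A τ e α β γ) F' x ∧
      ∀ u v, F' u v = -γ • (⟪A u, v⟫_ℝ • A x + ⟪A x, v⟫_ℝ • A u)
        + (2 * γ * ⟪A x, u⟫_ℝ) • A v
        + (2 * β * ⟪A x, u⟫_ℝ + γ * (-2 * τ * ⟪A x, u⟫_ℝ + 2 * ⟪A x, A u⟫_ℝ)) • v := by
  have hA' := A.hasFDerivAt (x := x)
  have h1 := hA'.inner ℝ (hasFDerivAt_id x)
  have h2 := hA'.inner ℝ hA'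
  have h3 := ((ContinuousLinearMap.smulRightL ℝ V V ∘L innerL V ∘L A).hasFDerivAt
    (x := x)).clm_apply hA'
  have h4 := (((h1.sub_const τ).const_mul β).const_add α).add
    ((((h1.const_mul τ).const_sub e).add h2).const_mul γ)
  have h5 := (((h3.const_smul γ).const_sub (γ • (A ∘L A))).add
    ((((h1.sub_const τ).const_mul γ).const_add β).smul (hasFDerivAt_const A x))).add
    (h4.smul (hasFDerivAt_const (ContinuousLinearMap.id ℝ V) x))
  refine ⟨_, h5, fun u v => ?_⟩
  have e1 : ⟪A u, x⟫_ℝ = ⟪A x, u⟫_ℝ := by rw [hA, real_inner_comm]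
  have e2 : ⟪A u, A x⟫_ℝ = ⟪A x, A u⟫_ℝ := real_inner_comm _ _
  simp [innerL_apply, e1, e2]
  module

end BenentiFields

theorem inner_covDerivEnd_projField {F : V → V →L[ℝ] V} {F' : V →L[ℝ] V →L[ℝ] V} {x : Sph V}
    (hF : HasFDerivAt F F' (x : V)) (u v w : Tan x) :
    ⟪covDerivEnd (projField F) x u v, w⟫_ℝ =
      ⟪F' u v, (w : V)⟫_ℝ - ⟪(x : V), F x v⟫_ℝ * ⟪(u : V), (w : V)⟫_ℝ
        - ⟪(u : V), (v : V)⟫_ℝ * ⟪F x x, (w : V)⟫_ℝ := by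
  rw [covDerivEnd_projField hF, inner_sub_left, inner_sub_left, inner_tanProj_left,
    real_inner_smul_left, real_inner_smul_left, inner_tanProj_left, Submodule.coe_inner]

theorem isSymmTensor_projField {F : V → V →L[ℝ] V} (hF : ContDiff ℝ ∞ F)
    (hs : ∀ x v w, ⟪F x v, w⟫_ℝ = ⟪v, F x w⟫_ℝ) : IsSymmTensor (projField F) where
  smooth := isSmooth_projField hF
  symm x v w := by
    rw [inner_projField, ← real_inner_comm v, inner_projField, hs, real_inner_comm]

/-! ### The Killing equation -/

section BenentiKilling

variable {A : V →L[ℝ] V} (hA : ∀ v w, ⟪A v, w⟫_ℝ = ⟪v, A w⟫_ℝ) (τ e α β γ : ℝ)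
include hA

theorem benentiAmbient_symm (x v w : V) :
    ⟪benentiAmbient A τ e α β γ x v, w⟫_ℝ = ⟪v, benentiAmbient A τ e α β γ x w⟫_ℝ := by
  simp only [benentiAmbient_apply, inner_add_left, inner_add_right, inner_sub_left,
    inner_sub_right, real_inner_smul_left, real_inner_smul_right, hA]
  rw [← hA x v, real_inner_comm v (A x)]
  ring

/-- In the cyclic sum, the term `2γ⟪Ax, u⟫⟪Av, w⟫` cancels against the two terms from
differentiating the rank one part. The derivative of the metric coefficient likewise cancels against
the two projection corrections. -/
theorem isKillingTensor_benentiAmbient :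
    IsKillingTensor (projField (benentiAmbient A τ e α β γ)) where
  toIsSymmTensor := isSymmTensor_projField (contDiff_benentiAmbient A τ e α β γ)
    (benentiAmbient_symm hA τ e α β γ)
  killing x u v w := by
    obtain ⟨F', hF', h⟩ := exists_hasFDerivAt_benentiAmbient A τ e α β γ hA (x : V)
    have key : ∀ v : V, ⟪(x : V), A v⟫_ℝ = ⟪A x, v⟫_ℝ := fun v => (hA _ _).symm
    have key3 : ∀ v : V, ⟪A (A x), v⟫_ℝ = ⟪A x, A v⟫_ℝ := fun v => hA _ _
    simp only [inner_covDerivEnd_projField hF', h, benentiAmbient_apply, inner_add_left,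
      inner_add_right, inner_sub_left, inner_sub_right, real_inner_smul_left,
      real_inner_smul_right, inner_sph_tan, key, key3]
    rw [real_inner_comm (v : V) (u : V), real_inner_comm (w : V) (v : V),
      real_inner_comm (w : V) (u : V), hA w u, real_inner_comm (A u) w, hA v u,
      real_inner_comm (A u) v, hA w v, real_inner_comm (A v) w]
    ring

end BenentiKilling

/-! ### Restrictions of constant tensors solve the Sinjukov equation -/

section ConstantRestrictions

theorem inner_covDerivEnd_const (A : V →L[ℝ] V) (hA : ∀ v w, ⟪A v, w⟫_ℝ = ⟪v, A w⟫_ℝ)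
    (x : Sph V) (u v w : Tan x) :
    ⟪covDerivEnd (projField fun _ => A) x u v, w⟫_ℝ =
      - ⟪A x, (v : V)⟫_ℝ * ⟪(u : V), (w : V)⟫_ℝ - ⟪(u : V), (v : V)⟫_ℝ * ⟪A x, (w : V)⟫_ℝ := by
  rw [inner_covDerivEnd_projField (hasFDerivAt_const A (x : V)), ← hA]
  simp

variable [FiniteDimensional ℝ V]

/-- By cyclicity this is the trace of `A` composed with the projection, that is, of `A` minus the
rank one map `v ↦ ⟪x, v⟫ Ax`. -/
theorem trace_projField_const (A : V →L[ℝ] V) (x : Sph V) :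
    LinearMap.trace ℝ (Tan x) (projField (fun _ => A) x) =
      LinearMap.trace ℝ V (A : V →ₗ[ℝ] V) - ⟪A x, (x : V)⟫_ℝ := by
  rw [projField, LinearMap.trace_comp_comm']
  have h : ((A : V →ₗ[ℝ] V) ∘ₗ (Tan x).subtype) ∘ₗ (tanProj x : V →ₗ[ℝ] Tan x) =
      (A : V →ₗ[ℝ] V) - LinearMap.smulRight (innerₗ V (x : V)) (A x) := by
    ext v
    simp only [LinearMap.comp_apply, Submodule.subtype_apply, ContinuousLinearMap.coe_coe,
      coe_tanProj]
    simp
  rw [h, map_sub, LinearMap.trace_smulRight, innerₗ_apply_apply, real_inner_comm]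

theorem restrict_eq_projField (A : Module.End ℝ V) :
    restrict A = projField fun _ => LinearMap.toContinuousLinearMap A := rfl

theorem isSpecialConformalKilling_restrict {A : Module.End ℝ V} (hA : A.IsSymmetric) :
    IsSpecialConformalKilling (restrict A) where
  toIsSymmTensor := by
    rw [restrict_eq_projField]
    exact isSymmTensor_projField contDiff_const fun _ => hA
  sinjukov x u v w := by
    set B : V →L[ℝ] V := LinearMap.toContinuousLinearMap A
    have hB : ∀ v w, ⟪B v, w⟫_ℝ = ⟪v, B w⟫_ℝ := hA
    have hd := (B.hasFDerivAt (x := (x : V))).inner ℝ (hasFDerivAt_id (x : V))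
    have hd' := hd.const_sub (LinearMap.trace ℝ V (B : V →ₗ[ℝ] V))
    have key : ∀ v : Tan x,
        dirDeriv (fun z => LinearMap.trace ℝ (Tan z) (projField (fun _ => B) z)) x v =
          -2 * ⟪B x, (v : V)⟫_ℝ := fun v => by
      rw [dirDeriv_eq_fderiv (trace_projField_const B) x hd'.differentiableAt]
      rw [show fderiv ℝ _ (x : V) = _ from hd'.fderiv]
      have e1 : ⟪B v, (x : V)⟫_ℝ = ⟪B x, (v : V)⟫_ℝ := by rw [hB, real_inner_comm]
      simp [e1]
      ring
    rw [restrict_eq_projField, inner_covDerivEnd_const B hB, key, key, Submodule.coe_inner,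
      Submodule.coe_inner, real_inner_comm (w : V) u, real_inner_comm (v : V) u]
    ring

end ConstantRestrictions

/-! ### The Nijenhuis integrability conditions -/

section Integrability

/-- Antisymmetrisation kills the contributions with a repeated basis vector, so only distinct
triples need checking. -/
theorem alt_eq_zero_of_basis {T : Type*} [AddCommGroup T] [Module ℝ T]
    (e : Module.Basis (Fin 3) ℝ T) {F : T → T → T → ℝ}
    (h₁ : ∀ b c, IsLinearMap ℝ fun a => F a b c) (h₂ : ∀ a c, IsLinearMap ℝ fun b => F a b c)
    (h₃ : ∀ a b, IsLinearMap ℝ fun c => F a b c)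
    (h : ∀ i j k, i ≠ j → j ≠ k → i ≠ k → F (e i) (e j) (e k) = 0) (a b c : T) :
    alt F a b c = 0 := by
  have a₁ : ∀ a a' b c, F (a + a') b c = F a b c + F a' b c := fun _ _ b c => (h₁ b c).map_add _ _
  have a₂ : ∀ a b b' c, F a (b + b') c = F a b c + F a b' c := fun a _ _ c => (h₂ a c).map_add _ _
  have a₃ : ∀ a b c c', F a b (c + c') = F a b c + F a b c' := fun a b _ _ => (h₃ a b).map_add _ _
  have s₁ : ∀ (r : ℝ) a b c, F (r • a) b c = r * F a b c := fun r _ b c => (h₁ b c).map_smul r _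
  have s₂ : ∀ (r : ℝ) a b c, F a (r • b) c = r * F a b c := fun r a _ c => (h₂ a c).map_smul r _
  have s₃ : ∀ (r : ℝ) a b c, F a b (r • c) = r * F a b c := fun r a b _ => (h₃ a b).map_smul r _
  rw [← e.sum_repr a, ← e.sum_repr b, ← e.sum_repr c]
  simp only [alt, Fin.sum_univ_three, a₁, a₂, a₃, s₁, s₂, s₃,
    h 0 1 2 (by decide) (by decide) (by decide), h 0 2 1 (by decide) (by decide) (by decide),
    h 1 0 2 (by decide) (by decide) (by decide), h 1 2 0 (by decide) (by decide) (by decide),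
    h 2 0 1 (by decide) (by decide) (by decide), h 2 1 0 (by decide) (by decide) (by decide)]
  ring

/-- Tensoriality of `∇K`, read off from the explicit formula; it allows `nijenhuis` to be expanded
linearly. -/
theorem exists_bilinear_covDerivEnd {F : V → V →L[ℝ] V} (hF : Differentiable ℝ F) (x : Sph V) :
    ∃ D : Tan x →ₗ[ℝ] Tan x →ₗ[ℝ] Tan x, ∀ u v, covDerivEnd (projField F) x u v = D u v := by
  have h := covDerivEnd_projField (hF (x : V)).hasFDerivAt
  refine ⟨LinearMap.mk₂ ℝ (covDerivEnd (projField F) x) ?_ ?_ ?_ ?_, fun _ _ => rfl⟩ <;>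
  · intros
    simp only [h, map_add, map_smul, add_apply, smul_apply, Submodule.coe_add, Submodule.coe_smul,
      inner_add_left, inner_add_right, real_inner_smul_left, real_inner_smul_right]
    module

/-- The Nijenhuis conditions for a tensor field that is diagonal at `x` in a basis in which the
off-diagonal components of its covariant derivative vanish. -/
theorem integrable_of_eigenbasis {F : V → V →L[ℝ] V} (hF : Differentiable ℝ F)
    (hsym : ∀ x, (projField F x).IsSymmetric)
    (h : ∀ x : Sph V, ∃ (e : OrthonormalBasis (Fin 3) ℝ (Tan x)) (k : Fin 3 → ℝ),
      (∀ i, projField F x (e i) = k i • e i) ∧ ∀ i j l, i ≠ j → j ≠ l → i ≠ l →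
        ⟪covDerivEnd (projField F) x (e i) (e j), e l⟫_ℝ = 0) :
    IsIntegrable (projField F) := by
  intro x
  obtain ⟨e, k, he, hd⟩ := h x
  obtain ⟨D, hD⟩ := exists_bilinear_covDerivEnd hF x
  set K : Module.End ℝ (Tan x) := projField F x with hK
  have hd' : ∀ i j l, i ≠ j → j ≠ l → i ≠ l → ⟪e l, D (e i) (e j)⟫_ℝ = 0 := fun i j l h1 h2 h3 => by
    rw [real_inner_comm, ← hD, hd i j l h1 h2 h3]
  have hs : ∀ v w, ⟪K v, w⟫_ℝ = ⟪v, K w⟫_ℝ := hsym x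
  -- The three conditions are the cases `B = 1, K, K²`, all diagonal in the basis `e`.
  have main : ∀ B : Module.End ℝ (Tan x), (∃ m : Fin 3 → ℝ, ∀ i w, ⟪e i, B w⟫_ℝ = m i * ⟪e i, w⟫_ℝ) →
      ∀ a b c, alt (fun a b c => ⟪a, B (nijenhuis (projField F) x b c)⟫_ℝ) a b c = 0 := by
    rintro B ⟨m, hm⟩
    refine alt_eq_zero_of_basis e.toBasis ?_ ?_ ?_ ?_
    · exact fun b c => ⟨fun _ _ => inner_add_left _ _ _, fun _ _ => real_inner_smul_left _ _ _⟩
    · refine fun a c => ⟨fun b b' => ?_, fun r b => ?_⟩ <;>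
      · simp only [nijenhuis, hD, ← hK, map_add, map_sub, map_smul, LinearMap.add_apply,
          LinearMap.smul_apply, inner_add_right, inner_sub_right, real_inner_smul_right,
          smul_eq_mul]
        ring
    · refine fun a c => ⟨fun b b' => ?_, fun r b => ?_⟩ <;>
      · simp only [nijenhuis, hD, ← hK, map_add, map_sub, map_smul, LinearMap.add_apply,
          LinearMap.smul_apply, inner_add_right, inner_sub_right, real_inner_smul_right,
          smul_eq_mul]
        ring
    · intro i j l h1 h2 h3
      -- `B` and `K` act by scalars on the basis, so every term of the component carries a factor of
      -- `∇K` with three distinct indices.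
      simp only [OrthonormalBasis.coe_toBasis, hm, nijenhuis, hD, ← hK, he, map_smul,
        LinearMap.smul_apply, inner_add_right, inner_sub_right, real_inner_smul_right,
        ← hs (e i), real_inner_smul_left, hd' l j i h2.symm h1.symm h3.symm,
        hd' j l i h2 h3.symm h1.symm]
      ring
  intro a b c
  refine ⟨main LinearMap.id ⟨1, fun i w => by simp⟩ a b c,
    main K ⟨k, fun i w => by rw [← hs, he, real_inner_smul_left]⟩ a b c,
    main (K ∘ₗ K) ⟨fun i => k i * k i, fun i w => ?_⟩ a b c⟩
  rw [LinearMap.comp_apply, ← hs, he, real_inner_smul_left, ← hs, he, real_inner_smul_left,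
    mul_assoc]

/-- The rank one term is exactly the discrepancy between the projection of `A²` and the square of
the projection of `A`. So the field is pointwise a polynomial in `L`: it shares the eigenvectors of
`L`, and all such fields commute. -/
theorem projField_benentiAmbient_apply (A : V →L[ℝ] V) (hA : ∀ v w, ⟪A v, w⟫_ℝ = ⟪v, A w⟫_ℝ)
    (τ e α β γ : ℝ) (x : Sph V) (v : Tan x) :
    projField (benentiAmbient A τ e α β γ) x v =
      γ • projField (fun _ => A) x (projField (fun _ => A) x v)
        + (β + γ * (⟪A x, (x : V)⟫_ℝ - τ)) • projField (fun _ => A) x v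
        + benentiScalar A τ e α β γ x • v := by
  simp only [projField_apply, coe_tanProj, benentiAmbient_apply, map_add, map_sub, map_smul,
    tanProj_coe, hA, smul_sub]

theorem finrank_tan (hV : Module.finrank ℝ V = 4) (x : Sph V) : Module.finrank ℝ (Tan x) = 3 := by
  have : Fact (Module.finrank ℝ V = 3 + 1) := ⟨hV⟩
  exact Submodule.finrank_orthogonal_span_singleton (coe_sph_ne_zero x)

theorem isIntegrable_benentiAmbient [FiniteDimensional ℝ V] (hV : Module.finrank ℝ V = 4) {A : V →L[ℝ] V}
    (hA : ∀ v w, ⟪A v, w⟫_ℝ = ⟪v, A w⟫_ℝ) (τ e α β γ : ℝ) :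
    IsIntegrable (projField (benentiAmbient A τ e α β γ)) := by
  refine integrable_of_eigenbasis
    ((contDiff_benentiAmbient A τ e α β γ).differentiable (by simp))
    (isKillingTensor_benentiAmbient hA τ e α β γ).symm fun x => ?_
  have hL : (projField (fun _ => A) x).IsSymmetric :=
    (isSymmTensor_projField contDiff_const fun _ => hA).symm x
  set b := hL.eigenvectorBasis (finrank_tan hV x)
  set l := hL.eigenvalues (finrank_tan hV x)
  have hbe : ∀ i, projField (fun _ => A) x (b i) = l i • b i :=
    fun i => hL.apply_eigenvectorBasis (finrank_tan hV x) i
  have ho : ∀ i j, i ≠ j → ⟪(b i : V), (b j : V)⟫_ℝ = 0 := fun i j hij =>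
    (Submodule.coe_inner (Tan x) (b i) (b j)).symm.trans (b.orthonormal.2 hij)
  have hAo : ∀ i j, i ≠ j → ⟪A (b i), (b j : V)⟫_ℝ = 0 := fun i j hij => by
    rw [← inner_projField (fun _ => A) x, hbe, real_inner_smul_left, b.orthonormal.2 hij, mul_zero]
  refine ⟨b, fun i => γ * l i * l i + (β + γ * (⟪A x, (x : V)⟫_ℝ - τ)) * l i
    + benentiScalar A τ e α β γ x, fun i => ?_, ?_⟩
  · rw [projField_benentiAmbient_apply A hA, hbe, map_smul, hbe, smul_smul, smul_smul, smul_smul,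
      ← add_smul, ← add_smul]
  -- Every term of `∇K` contains `g` or `A` paired on two of the three distinct eigenvectors, hence
  -- vanishes.
  · intro i j l h1 h2 h3
    obtain ⟨F', hF', h⟩ := exists_hasFDerivAt_benentiAmbient A τ e α β γ hA (x : V)
    rw [inner_covDerivEnd_projField hF', h]
    simp [inner_add_left, real_inner_smul_left, ho i l h3, ho i j h1, ho j l h2, hAo i l h3,
      hAo i j h1, hAo j l h2]

end Integrability

/-! ### The adjugate in dimension three and the Benenti system -/

section Adjugate

theorem endAdj_of_finrank_eq_three {T : Type*} [AddCommGroup T] [Module ℝ T]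
    [FiniteDimensional ℝ T] (hT : Module.finrank ℝ T = 3) (B : Module.End ℝ T) :
    endAdj B = B * B - LinearMap.trace ℝ T B • B
      + (1 / 2 * (LinearMap.trace ℝ T B ^ 2 - LinearMap.trace ℝ T (B * B))) • 1 := by
  let b : Module.Basis (Fin 3) ℝ T := Module.finBasisOfFinrankEq ℝ T hT
  rw [endAdj_eq b]
  apply (LinearMap.toMatrix b b).injective
  rw [LinearMap.toMatrix_toLin, map_add, map_sub, map_smul, map_smul, LinearMap.toMatrix_mul,
    LinearMap.trace_eq_matrix_trace ℝ b, LinearMap.trace_eq_matrix_trace ℝ b,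
    LinearMap.toMatrix_mul, LinearMap.toMatrix_one]
  generalize LinearMap.toMatrix b b B = M
  rw [Matrix.adjugate_fin_three]
  ext i j
  fin_cases i <;> fin_cases j <;>
  · simp [Matrix.mul_apply, Fin.sum_univ_three, Matrix.trace]
    ring

/-- All `2 × 2` minors of a rank one matrix vanish. -/
theorem endAdj_eq_zero_of_rank_one {T : Type*} [AddCommGroup T] [Module ℝ T]
    [FiniteDimensional ℝ T] (hT : Module.finrank ℝ T = 3) (B : Module.End ℝ T) (w : T)
    (hB : ∀ v, ∃ c : ℝ, c • w = B v) : endAdj B = 0 := by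
  let b : Module.Basis (Fin 3) ℝ T := Module.finBasisOfFinrankEq ℝ T hT
  choose c hc using hB
  have hM : LinearMap.toMatrix b b B = Matrix.of fun i j => c (b j) * b.repr w i := by
    ext i j
    rw [LinearMap.toMatrix_apply, ← hc]
    simp
  rw [endAdj_eq b, hM, Matrix.adjugate_fin_three, LinearEquiv.map_eq_zero_iff]
  ext i j
  fin_cases i <;> fin_cases j <;>
  · simp
    ring

theorem projField_const_mul_self (A : V →L[ℝ] V) (hA : ∀ v w, ⟪A v, w⟫_ℝ = ⟪v, A w⟫_ℝ)
    (x : Sph V) : projField (fun _ => A) x * projField (fun _ => A) x =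
      projField (fun _ => A ∘L A - rankOneSq (A x)) x := by
  ext v : 1
  rw [Module.End.mul_apply, projField_apply, projField_apply, coe_tanProj, projField_apply]
  simp [rankOneSq_apply, hA]

variable [FiniteDimensional ℝ V]

/-- The second elementary symmetric function of the eigenvalues of an endomorphism. -/
def secondSymm (A : Module.End ℝ V) : ℝ :=
  1 / 2 * (LinearMap.trace ℝ V A ^ 2 - LinearMap.trace ℝ V (A * A))

/-- The field `α K₂ + β K₁ + γ K₀`, where `K₂, K₁, K₀` are the coefficients of the Benenti system
of the restriction of `A`. -/
def benentiField (A : Module.End ℝ V) (α β γ : ℝ) : EndField V :=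
  projField (benentiAmbient (LinearMap.toContinuousLinearMap A) (LinearMap.trace ℝ V A)
    (secondSymm A) α β γ)

/-- With `τ`, `e` the first two symmetric functions of `A`, one has `tr L = τ - ⟪Ax, x⟫` and `e₂(L)
= e - τ⟪Ax, x⟫ + ⟪Ax, Ax⟫`. Then `Adj (L - t) = L² + (t - tr L) L + t² - t tr L + e₂(L)`. -/
theorem benenti_restrict (hV : Module.finrank ℝ V = 4) {A : Module.End ℝ V} (hA : A.IsSymmetric)
    (t : ℝ) : benenti (restrict A) t = benentiField A (t ^ 2) t 1 := by
  funext x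
  set B : V →L[ℝ] V := LinearMap.toContinuousLinearMap A
  have hBs : ∀ v w, ⟪B v, w⟫_ℝ = ⟪v, B w⟫_ℝ := hA
  have hT := finrank_tan hV x
  set L : Module.End ℝ (Tan x) := projField (fun _ => B) x with hL
  have h1 : LinearMap.trace ℝ (Tan x) L = LinearMap.trace ℝ V A - ⟪B x, (x : V)⟫_ℝ :=
    trace_projField_const B x
  have h2 : LinearMap.trace ℝ (Tan x) (L * L) =
      LinearMap.trace ℝ V (A * A) - 2 * ⟪B x, B x⟫_ℝ + ⟪B x, (x : V)⟫_ℝ ^ 2 := by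
    have e1 : ((B ∘L B - rankOneSq (B x) : V →L[ℝ] V) : V →ₗ[ℝ] V) =
        A * A - LinearMap.smulRight (innerₗ V (B x)) (B x) := rfl
    rw [hL, projField_const_mul_self B hBs, trace_projField_const, e1, map_sub,
      LinearMap.trace_smulRight]
    simp only [FunLike.coe_sub, Pi.sub_apply, ContinuousLinearMap.comp_apply,
      inner_sub_left, rankOneSq_apply, real_inner_smul_left, hBs (B x), innerₗ_apply_apply]
    ring
  have h3 : (L - t • 1) * (L - t • 1) = L * L - (2 * t) • L + (t ^ 2) • 1 := by
    rw [sub_mul, mul_sub, mul_sub, smul_mul_smul_comm, smul_one_mul, mul_smul_one, mul_one]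
    module
  have h4 : LinearMap.trace ℝ (Tan x) 1 = 3 := by rw [LinearMap.trace_one, hT]; norm_num
  have h5 : benenti (restrict A) t x = endAdj (L - t • 1) := rfl
  rw [h5, endAdj_of_finrank_eq_three hT, h3]
  simp only [map_sub, map_add, map_smul, h1, h2, h4, smul_eq_mul]
  ext v : 1
  rw [benentiField, projField_benentiAmbient_apply _ hBs, ← hL]
  simp only [LinearMap.add_apply, LinearMap.sub_apply, LinearMap.smul_apply, Module.End.mul_apply,
    Module.End.one_apply, benentiScalar, secondSymm]
  module

theorem benentiField_eq (A : Module.End ℝ V) (α β γ : ℝ) :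
    benentiField A α β γ =
      α • benentiField A 1 0 0 + β • benentiField A 0 1 0 + γ • benentiField A 0 0 1 := by
  funext x
  ext v : 1
  simp only [Pi.add_apply, Pi.smul_apply, LinearMap.add_apply, LinearMap.smul_apply, benentiField,
    projField_apply, ← map_smul, ← map_add]
  congr 1
  simp only [benentiAmbient_apply, benentiScalar, map_smul]
  module

end Adjugate

/-! ### Linear independence and the Stäckel criterion -/

section StackelCriterion

/-- Since `ai ≠ aj`, differences of the equations give `γ ak = β = γ al`. If `γ = 0`, everything
vanishes. Otherwise `ak = al`, and the last two equations give `(ak - ai)(ak - aj) = 0`, a triple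
coincidence. -/
theorem coeffs_eq_zero_of_ne {α β γ ai aj ak al : ℝ} (hij : ai ≠ aj)
    (h₁ : α - β * (ai + ak) + γ * (ai * ak) = 0) (h₂ : α - β * (aj + ak) + γ * (aj * ak) = 0)
    (h₃ : α - β * (ai + al) + γ * (ai * al) = 0) (h₄ : α - β * (aj + al) + γ * (aj * al) = 0)
    (h₅ : α - β * (ak + al) + γ * (ak * al) = 0) (h₆ : α - β * (ai + aj) + γ * (ai * aj) = 0)
    (hi : ¬ (ai = ak ∧ ak = al)) (hj : ¬ (aj = ak ∧ ak = al)) : α = 0 ∧ β = 0 ∧ γ = 0 := by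
  have hk : γ * ak = β := mul_left_cancel₀ (sub_ne_zero.mpr hij) (by linear_combination h₁ - h₂)
  have hl : γ * al = β := mul_left_cancel₀ (sub_ne_zero.mpr hij) (by linear_combination h₃ - h₄)
  by_cases hγ : γ = 0
  · subst hγ
    have hβ : β = 0 := by linarith
    subst hβ
    exact ⟨by linarith, rfl, rfl⟩
  · have hkl : ak = al := mul_left_cancel₀ hγ (hk.trans hl.symm)
    subst hkl
    have h : γ * ((ak - ai) * (ak - aj)) = 0 := by
      linear_combination h₆ - h₅ + (2 * ak - ai - aj) * hk
    rcases mul_eq_zero.mp ((mul_eq_zero.mp h).resolve_left hγ) with h | h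
    · exact absurd ⟨(sub_eq_zero.mp h).symm, rfl⟩ hi
    · exact absurd ⟨(sub_eq_zero.mp h).symm, rfl⟩ hj

theorem coeffs_eq_zero {α β γ : ℝ} {a : Fin 4 → ℝ}
    (h : ∀ i j, i ≠ j → α - β * (a i + a j) + γ * (a i * a j) = 0)
    (hn : ∀ i j k, i ≠ j → j ≠ k → i ≠ k → ¬ (a i = a j ∧ a j = a k)) :
    α = 0 ∧ β = 0 ∧ γ = 0 := by
  have key : ∀ i j k l : Fin 4, i ≠ j → i ≠ k → i ≠ l → j ≠ k → j ≠ l → k ≠ l → a i ≠ a j →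
      α = 0 ∧ β = 0 ∧ γ = 0 := fun i j k l hij hik hil hjk hjl hkl ha =>
    coeffs_eq_zero_of_ne ha (h i k hik) (h j k hjk) (h i l hil) (h j l hjl) (h k l hkl) (h i j hij)
      (hn i k l hik hkl hil) (hn j k l hjk hkl hjl)
  by_cases h01 : a 0 = a 1
  · exact key 1 2 0 3 (by decide) (by decide) (by decide) (by decide) (by decide) (by decide)
      fun h12 => hn 0 1 2 (by decide) (by decide) (by decide) ⟨h01, h12⟩
  · exact key 0 1 2 3 (by decide) (by decide) (by decide) (by decide) (by decide) (by decide) h01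

variable [FiniteDimensional ℝ V]

theorem three_le_finrank_eigenspace {A : Module.End ℝ V} (b : OrthonormalBasis (Fin 4) ℝ V)
    {a : Fin 4 → ℝ} (hb : ∀ i, A (b i) = a i • b i) {i j k : Fin 4} (hij : i ≠ j) (hjk : j ≠ k)
    (hik : i ≠ k) (h : a i = a j ∧ a j = a k) :
    3 ≤ Module.finrank ℝ (Module.End.eigenspace A (a k)) := by
  let f : Fin 3 → Fin 4 := ![i, j, k]
  have hf : Function.Injective f := by
    intro m n
    fin_cases m <;> fin_cases n <;> simp [f, hij, hjk, hik, hij.symm, hjk.symm, hik.symm]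
  have hmem : ∀ m, b (f m) ∈ Module.End.eigenspace A (a k) := fun m => by
    rw [Module.End.mem_eigenspace_iff, hb]
    congr 1
    fin_cases m
    · exact h.1.trans h.2
    · exact h.2
    · rfl
  have hli : LinearIndependent ℝ
      fun m => (⟨b (f m), hmem m⟩ : Module.End.eigenspace A (a k)) :=
    LinearIndependent.of_comp (Module.End.eigenspace A (a k)).subtype
      (b.orthonormal.linearIndependent.comp f hf)
  simpa using hli.fintype_card_le_finrank

theorem benentiField_eq_zero_iff_of_no_triple (hV : Module.finrank ℝ V = 4) {A : Module.End ℝ V}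
    (hA : A.IsSymmetric) (hn : ¬ ∃ μ : ℝ, 3 ≤ Module.finrank ℝ (Module.End.eigenspace A μ))
    {α β γ : ℝ} (h : benentiField A α β γ = 0) : α = 0 ∧ β = 0 ∧ γ = 0 := by
  set b := hA.eigenvectorBasis hV
  set a := hA.eigenvalues hV
  have hb : ∀ i, A (b i) = a i • b i := hA.apply_eigenvectorBasis hV
  have hB : ∀ i, LinearMap.toContinuousLinearMap A (b i) = a i • b i := hb
  have ho : ∀ i j, ⟪b i, b j⟫_ℝ = if i = j then 1 else 0 := orthonormal_iff_ite.mp b.orthonormal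
  have hτ : LinearMap.trace ℝ V A = a 0 + a 1 + a 2 + a 3 := by
    simp [LinearMap.trace_eq_sum_inner A b, hb, real_inner_smul_right, Fin.sum_univ_four]
  have hτ2 : LinearMap.trace ℝ V (A * A) = a 0 ^ 2 + a 1 ^ 2 + a 2 ^ 2 + a 3 ^ 2 := by
    simp [LinearMap.trace_eq_sum_inner (A * A) b, hb, real_inner_smul_right,
      Fin.sum_univ_four, pow_two]
  -- At the point `b k`, the tangent vector `b l` is an eigenvector of the field; this is its
  -- eigenvalue.
  have key : ∀ k l, k ≠ l → γ * a l ^ 2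
      + (β + γ * (a k - LinearMap.trace ℝ V A)) * a l + (α + β * (a k - LinearMap.trace ℝ V A)
      + γ * (secondSymm A - LinearMap.trace ℝ V A * a k + a k ^ 2)) = 0 := fun k l hkl => by
    let x : Sph V := ⟨b k, mem_sphere_zero_iff_norm.mpr (b.orthonormal.1 k)⟩
    let v : Tan x := ⟨b l, Submodule.mem_orthogonal_singleton_iff_inner_right.mpr
      (b.orthonormal.2 hkl)⟩
    have h1 : ⟪benentiField A α β γ x v, v⟫_ℝ = 0 := by simp [h]
    rw [benentiField, inner_projField, benentiAmbient_apply] at h1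
    simp only [x, v, hB, benentiScalar, inner_add_left, inner_sub_left, real_inner_smul_left,
      real_inner_smul_right, ho, hkl, map_smul, if_true, if_false] at h1
    linear_combination h1
  refine coeffs_eq_zero (a := a) ?_ fun i j k h1 h2 h3 h4 =>
    hn ⟨a k, three_le_finrank_eigenspace b hb h1 h2 h3 h4⟩
  simp only [secondSymm, hτ, hτ2] at key
  have sym : ∀ i j, α - β * (a i + a j) + γ * (a i * a j) = 0 →
      α - β * (a j + a i) + γ * (a j * a i) = 0 := fun i j h => by linear_combination h
  -- Once the traces are expanded, the equation for `(k, l)` concerns only the complementary pair of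
  -- eigenvalues.
  have p01 : α - β * (a 0 + a 1) + γ * (a 0 * a 1) = 0 := by
    linear_combination key 2 3 (by decide)
  have p02 : α - β * (a 0 + a 2) + γ * (a 0 * a 2) = 0 := by
    linear_combination key 1 3 (by decide)
  have p03 : α - β * (a 0 + a 3) + γ * (a 0 * a 3) = 0 := by
    linear_combination key 1 2 (by decide)
  have p12 : α - β * (a 1 + a 2) + γ * (a 1 * a 2) = 0 := by
    linear_combination key 0 3 (by decide)
  have p13 : α - β * (a 1 + a 3) + γ * (a 1 * a 3) = 0 := by
    linear_combination key 0 2 (by decide)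
  have p23 : α - β * (a 2 + a 3) + γ * (a 2 * a 3) = 0 := by
    linear_combination key 0 1 (by decide)
  intro i j hij
  fin_cases i <;> fin_cases j <;>
    first
    | exact absurd rfl hij
    | assumption
    | exact sym _ _ ‹_›

theorem benenti_eq_zero_of_triple (hV : Module.finrank ℝ V = 4) {A : Module.End ℝ V}
    (hA : A.IsSymmetric) {μ : ℝ} (hμ : 3 ≤ Module.finrank ℝ (Module.End.eigenspace A μ)) :
    benenti (restrict A) μ = 0 := by
  set W := Module.End.eigenspace A μ with hW
  have h1 : Module.finrank ℝ Wᗮ ≤ 1 := by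
    have := W.finrank_add_finrank_orthogonal
    omega
  obtain ⟨w, hw⟩ := finrank_le_one_iff.mp h1
  -- The image of `A - μ` lies in `Wᗮ`, which is at most a line, so its compression to any tangent
  -- space has rank at most one.
  have h2 : ∀ v, A v - μ • v ∈ Wᗮ := fun v => by
    rw [Submodule.mem_orthogonal]
    intro u hu
    rw [inner_sub_right, ← hA, Module.End.mem_eigenspace_iff.mp hu, real_inner_smul_left,
      real_inner_smul_right, sub_self]
  funext x
  refine endAdj_eq_zero_of_rank_one (finrank_tan hV x) _ (tanProj x w) fun v => ?_
  obtain ⟨c, hc⟩ := hw ⟨_, h2 v⟩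
  refine ⟨c, ?_⟩
  have h3 : c • (w : V) = A v - μ • (v : V) := congrArg Subtype.val hc
  rw [← map_smul, h3, map_sub, map_smul, tanProj_coe]
  rfl

theorem commute_benentiField {A : Module.End ℝ V} (hA : A.IsSymmetric) (α β γ α' β' γ' : ℝ)
    (x : Sph V) : Commute (benentiField A α β γ x) (benentiField A α' β' γ' x) := by
  have hA' : ∀ v w, ⟪LinearMap.toContinuousLinearMap A v, w⟫_ℝ =
      ⟪v, LinearMap.toContinuousLinearMap A w⟫_ℝ := hA
  ext v : 1
  simp only [Module.End.mul_apply, benentiField, projField_benentiAmbient_apply _ hA', map_add,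
    map_smul]
  module

theorem mem_span_benentiField {A : Module.End ℝ V} {K : EndField V}
    (hK : K ∈ Submodule.span ℝ
      {benentiField A 0 0 1, benentiField A 0 1 0, benentiField A 1 0 0}) :
    ∃ α β γ : ℝ, K = benentiField A α β γ := by
  obtain ⟨γ, β, α, rfl⟩ := Submodule.mem_span_triple.mp hK
  refine ⟨α, β, γ, ?_⟩
  rw [benentiField_eq A α β γ]
  abel

theorem finrank_span_benentiField (hV : Module.finrank ℝ V = 4) {A : Module.End ℝ V}
    (hA : A.IsSymmetric) :
    Module.finrank ℝ (Submodule.span ℝ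
      {benentiField A 0 0 1, benentiField A 0 1 0, benentiField A 1 0 0}) = 3 ↔
      ¬ ∃ μ : ℝ, 3 ≤ Module.finrank ℝ (Module.End.eigenspace A μ) := by
  let K : Fin 3 → EndField V := ![benentiField A 0 0 1, benentiField A 0 1 0, benentiField A 1 0 0]
  have hr : Set.range K = {benentiField A 0 0 1, benentiField A 0 1 0, benentiField A 1 0 0} := by
    ext
    simp [K]
    tauto
  have hsum : ∀ g : Fin 3 → ℝ, ∑ i, g i • K i = benentiField A (g 2) (g 1) (g 0) := fun g => by
    rw [benentiField_eq A (g 2), Fin.sum_univ_three]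
    simp only [K, Matrix.cons_val]
    abel
  have hli : LinearIndependent ℝ K ↔
      ¬ ∃ μ : ℝ, 3 ≤ Module.finrank ℝ (Module.End.eigenspace A μ) := by
    rw [Fintype.linearIndependent_iff]
    constructor
    -- `K(μ) = 0` is a nontrivial relation, since the coefficient of `K₀` is `1`.
    · rintro h ⟨μ, hμ⟩
      have h0 := benenti_eq_zero_of_triple hV hA hμ
      rw [benenti_restrict hV hA] at h0
      have := h ![1, μ, μ ^ 2] ((hsum _).trans h0) 0
      simp at this
    · intro h g hg
      rw [hsum] at hg
      obtain ⟨h2, h1, h0⟩ := benentiField_eq_zero_iff_of_no_triple hV hA h hg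
      intro i
      fin_cases i
      exacts [h0, h1, h2]
  rw [← hli, linearIndependent_iff_card_eq_finrank_span, Fintype.card_fin, hr, Set.finrank, eq_comm]

theorem isStackelSystem_span_benentiField_iff (hV : Module.finrank ℝ V = 4) {A : Module.End ℝ V}
    (hA : A.IsSymmetric) :
    IsStackelSystem (Submodule.span ℝ
      {benentiField A 0 0 1, benentiField A 0 1 0, benentiField A 1 0 0}) ↔
      ¬ ∃ μ : ℝ, 3 ≤ Module.finrank ℝ (Module.End.eigenspace A μ) := by
  have hA' : ∀ v w, ⟪LinearMap.toContinuousLinearMap A v, w⟫_ℝ =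
      ⟪v, LinearMap.toContinuousLinearMap A w⟫_ℝ := hA
  rw [← finrank_span_benentiField hV hA]
  refine ⟨fun h => ?_, fun h => ⟨by rw [h, hV], fun K hK => ?_, fun K hK => ?_,
    fun K hK K' hK' x => ?_⟩⟩
  · have := h.dim
    omega
  · obtain ⟨α, β, γ, rfl⟩ := mem_span_benentiField hK
    exact isKillingTensor_benentiAmbient hA' _ _ α β γ
  · obtain ⟨α, β, γ, rfl⟩ := mem_span_benentiField hK
    exact isIntegrable_benentiAmbient hV hA' _ _ α β γ
  · obtain ⟨α, β, γ, rfl⟩ := mem_span_benentiField hK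
    obtain ⟨α', β', γ', rfl⟩ := mem_span_benentiField hK'
    exact commute_benentiField hA α β γ α' β' γ' x

end StackelCriterion

/-! ### Solutions of the Sinjukov equation are restrictions of constant tensors -/

section SinjukovEquation

theorem covDerivEnd_eq_covDeriv (K : EndField V) (x : Sph V) (u v : Tan x) :
    covDerivEnd K x u v = covDeriv (fun z => K z (tanField (v : V) z)) x u := by
  rw [covDerivEnd, covDeriv_tanField, map_zero, sub_zero]

theorem differentiableAt_radialExt {K : EndField V} (hK : IsSmooth K) (v : V) {y : V}
    (hy : y ≠ 0) : DifferentiableAt ℝ (radialExt fun z => (K z (tanField v z) : V)) y :=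
  ((hK v).contDiffAt (isOpen_compl_singleton.mem_nhds hy)).differentiableAt (by simp)

variable {E : Type*} [NormedAddCommGroup E] [NormedSpace ℝ E]

/-- Euler's relation for a function that is constant along rays. -/
theorem fderiv_radialExt_self {f : Sph V → E} {y : V}
    (hf : DifferentiableAt ℝ (radialExt f) y) : fderiv ℝ (radialExt f) y y = 0 := by
  have h1 : HasDerivAt (fun t : ℝ => (1 + t) • y) y 0 := by
    simpa using ((hasDerivAt_id (0 : ℝ)).const_add 1).smul_const y
  have h0 : (1 + (0 : ℝ)) • y = y := by simp
  have h2 : HasDerivAt (fun t : ℝ => radialExt f ((1 + t) • y)) (fderiv ℝ (radialExt f) y y) 0 := by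
    have hf' : HasFDerivAt (radialExt f) (fderiv ℝ (radialExt f) y) ((1 + (0 : ℝ)) • y) := by
      rw [h0]
      exact hf.hasFDerivAt
    exact hf'.comp_hasDerivAt (0 : ℝ) h1
  refine h2.unique ((hasDerivAt_const (0 : ℝ) (radialExt f y)).congr_of_eventuallyEq ?_)
  filter_upwards [lt_mem_nhds (show (-1 : ℝ) < 0 by norm_num)] with t ht
  exact radialExt_smul f (by linarith) y

theorem fderiv_radialExt_smul {f : Sph V → E} {c : ℝ} (hc : 0 < c) {y : V}
    (hf : DifferentiableAt ℝ (radialExt f) (c • y)) (w : V) :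
    fderiv ℝ (radialExt f) y w = c • fderiv ℝ (radialExt f) (c • y) w := by
  have h1 : HasFDerivAt (fun z : V => c • z) (c • ContinuousLinearMap.id ℝ V) y :=
    (hasFDerivAt_id y).const_smul c
  have h2 := hf.hasFDerivAt.comp y h1
  have h3 : radialExt f ∘ (fun z : V => c • z) = radialExt f :=
    funext fun z => radialExt_smul f hc z
  rw [h3] at h2
  rw [h2.fderiv]
  simp

/-- For a special conformal Killing tensor, the component `L(e,e)` has vanishing derivative in
directions orthogonal to `e`, at points orthogonal to `e`. -/
theorem IsSpecialConformalKilling.fderiv_component {L : EndField V}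
    (hL : IsSpecialConformalKilling L) {e y w : V} (hy : y ≠ 0) (hey : ⟪e, y⟫_ℝ = 0)
    (hew : ⟪e, w⟫_ℝ = 0) :
    ⟪e, fderiv ℝ (radialExt fun z => (L z (tanField e z) : V)) y w⟫_ℝ = 0 := by
  have hn : 0 < ‖y‖⁻¹ := inv_pos.mpr (norm_pos_iff.mpr hy)
  let x : Sph V := ⟨‖y‖⁻¹ • y, by
    rw [mem_sphere_zero_iff_norm, norm_smul, norm_inv, norm_norm,
      inv_mul_cancel₀ (norm_ne_zero_iff.mpr hy)]⟩
  have hx : (x : V) = ‖y‖⁻¹ • y := rfl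
  have hex : ⟪e, (x : V)⟫_ℝ = 0 := by rw [hx, real_inner_smul_right, hey, mul_zero]
  let v : Tan x := ⟨e, Submodule.mem_orthogonal_singleton_iff_inner_left.mpr hex⟩
  let u : Tan x := tanProj x w
  -- The radial part of `w` does not contribute to the derivative, and the tangential part is
  -- orthogonal to `e`, so the right side of the Sinjukov equation vanishes.
  have hw : w = u + ⟪(x : V), w⟫_ℝ • (x : V) := by
    rw [coe_tanProj]; abel
  have huv : ⟪(v : V), (u : V)⟫_ℝ = 0 := by
    rw [coe_tanProj, inner_sub_right, real_inner_smul_right, hex, hew, mul_zero, sub_zero]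
  have hd := differentiableAt_radialExt hL.smooth e (coe_sph_ne_zero x)
  have key := hL.sinjukov x u v v
  rw [Submodule.coe_inner _ v u, huv, covDerivEnd_eq_covDeriv, covDeriv,
    inner_tanProj_left, dirDeriv, real_inner_comm] at key
  have hself := fderiv_radialExt_self hd
  rw [fderiv_radialExt_smul hn hd, ← hx, hw, map_add, map_smul, hself, smul_zero, add_zero,
    real_inner_smul_right]
  simp only [mul_zero, add_zero] at key
  exact mul_eq_zero_of_right _ key

/-- The bilinear form on `V` that corresponds to an endomorphism field at a point. -/
def fieldForm (L : EndField V) (x : Sph V) (v w : V) : ℝ := ⟪L x (tanProj x v), tanProj x w⟫_ℝ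

theorem fieldForm_add_left (L : EndField V) (x : Sph V) (v v' w : V) :
    fieldForm L x (v + v') w = fieldForm L x v w + fieldForm L x v' w := by
  simp only [fieldForm, map_add, inner_add_left]

theorem fieldForm_smul_left (L : EndField V) (x : Sph V) (r : ℝ) (v w : V) :
    fieldForm L x (r • v) w = r * fieldForm L x v w := by
  simp only [fieldForm, map_smul, real_inner_smul_left]

theorem fieldForm_symm {L : EndField V} (hL : IsSymmTensor L) (x : Sph V) (v w : V) :
    fieldForm L x v w = fieldForm L x w v := by
  rw [fieldForm, hL.symm x, real_inner_comm, fieldForm]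

theorem fieldForm_polarization {L : EndField V} (hL : IsSymmTensor L) (x : Sph V) (v w : V) :
    4 * fieldForm L x v w = fieldForm L x (v + w) (v + w) - fieldForm L x (v - w) (v - w) := by
  have h := fieldForm_symm hL x v w
  simp only [fieldForm, map_add, map_sub, inner_add_left, inner_add_right, inner_sub_left,
    inner_sub_right] at h ⊢
  linarith

variable [FiniteDimensional ℝ V]

/-- For a special conformal Killing tensor, `L(e,e)` takes the same value at all points of the
sphere that are orthogonal to `e`. -/
theorem IsSpecialConformalKilling.component_eq (hV : Module.finrank ℝ V = 4) {L : EndField V}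
    (hL : IsSpecialConformalKilling L) {e : V} {x y : Sph V} (hx : ⟪e, (x : V)⟫_ℝ = 0)
    (hy : ⟪e, (y : V)⟫_ℝ = 0) :
    ⟪e, (L x (tanField e x) : V)⟫_ℝ = ⟪e, (L y (tanField e y) : V)⟫_ℝ := by
  let W : Submodule ℝ V := (ℝ ∙ e)ᗮ
  -- The hyperplane `W` (all of `V` if `e = 0`) has dimension above one, so it stays connected when
  -- the origin is removed.
  have hW : 1 < Module.rank ℝ W := by
    have h1 := (ℝ ∙ e).finrank_add_finrank_orthogonal
    have h2 := (finrank_span_le_card ({e} : Set V) (R := ℝ))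
    rw [Set.toFinset_singleton, Finset.card_singleton] at h2
    exact Module.lt_rank_of_lt_finrank (by change 1 < Module.finrank ℝ (ℝ ∙ e)ᗮ; omega)
  have hWe : ∀ w : W, ⟪e, (w : V)⟫_ℝ = 0 := fun w =>
    Submodule.mem_orthogonal_singleton_iff_inner_right.mp w.2
  let f : V → V := radialExt fun z => (L z (tanField e z) : V)
  have hd : ∀ w : W, w ≠ 0 → HasFDerivAt (fun w : W => ⟪e, f w⟫_ℝ)
      (innerSL ℝ e ∘L fderiv ℝ f w ∘L W.subtypeL) w := fun w hw => by
    have h1 := (differentiableAt_radialExt hL.smooth e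
      (fun h => hw (Subtype.ext h) : (w : V) ≠ 0)).hasFDerivAt
    have h2 : HasFDerivAt (fun w : W => f w) (fderiv ℝ f w ∘L W.subtypeL) w :=
      HasFDerivAt.comp w h1 W.subtypeL.hasFDerivAt
    exact (innerSL ℝ e).hasFDerivAt.comp w h2
  have hne : ∀ (z : Sph V) (hz : (z : V) ∈ W), (⟨z, hz⟩ : W) ∈ ({0}ᶜ : Set W) := fun z hz h =>
    coe_sph_ne_zero z (congrArg Subtype.val h)
  have hxW : (x : V) ∈ W := Submodule.mem_orthogonal_singleton_iff_inner_right.mpr hx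
  have hyW : (y : V) ∈ W := Submodule.mem_orthogonal_singleton_iff_inner_right.mpr hy
  have := isOpen_compl_singleton.is_const_of_fderiv_eq_zero (𝕜 := ℝ)
    (f := fun w : W => ⟪e, f w⟫_ℝ) (isConnected_compl_singleton_of_one_lt_rank hW 0).isPreconnected
    (fun w hw => (hd w hw).differentiableAt.differentiableWithinAt)
    (fun w hw => by
      rw [(hd w hw).fderiv]
      ext v
      exact hL.fderiv_component (fun h => hw (Subtype.ext h)) (hWe w) (hWe v))
    (hne x hxW) (hne y hyW)
  simpa only [f, radialExt_coe] using this

theorem exists_sph_orthogonal (hV : Module.finrank ℝ V = 4) (u v w : V) :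
    ∃ x : Sph V, ⟪u, (x : V)⟫_ℝ = 0 ∧ ⟪v, (x : V)⟫_ℝ = 0 ∧ ⟪w, (x : V)⟫_ℝ = 0 := by
  classical
  let S : Submodule ℝ V := Submodule.span ℝ (({u, v, w} : Finset V) : Set V)
  have h1 : Module.finrank ℝ S ≤ 3 :=
    (finrank_span_finset_le_card _).trans Finset.card_le_three
  have h2 := S.finrank_add_finrank_orthogonal
  have h3 : Sᗮ ≠ ⊥ := fun h => by
    rw [h, finrank_bot] at h2
    omega
  obtain ⟨y, hy, hy0⟩ := Submodule.exists_mem_ne_zero_of_ne_bot h3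
  have h4 : ∀ z ∈ ({u, v, w} : Finset V), ⟪z, ‖y‖⁻¹ • y⟫_ℝ = 0 := fun z hz => by
    rw [real_inner_smul_right, (Submodule.mem_orthogonal S y).mp hy z (Submodule.subset_span hz),
      mul_zero]
  refine ⟨⟨‖y‖⁻¹ • y, ?_⟩, h4 u (by simp), h4 v (by simp), h4 w (by simp)⟩
  rw [mem_sphere_zero_iff_norm, norm_smul, norm_inv, norm_norm,
    inv_mul_cancel₀ (norm_ne_zero_iff.mpr hy0)]

theorem IsSpecialConformalKilling.fieldForm_eq (hV : Module.finrank ℝ V = 4) {L : EndField V}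
    (hL : IsSpecialConformalKilling L) {v w : V} {x y : Sph V} (hvx : ⟪v, (x : V)⟫_ℝ = 0)
    (hwx : ⟪w, (x : V)⟫_ℝ = 0) (hvy : ⟪v, (y : V)⟫_ℝ = 0) (hwy : ⟪w, (y : V)⟫_ℝ = 0) :
    fieldForm L x v w = fieldForm L y v w := by
  have diag : ∀ e : V, ⟪e, (x : V)⟫_ℝ = 0 → ⟪e, (y : V)⟫_ℝ = 0 →
      fieldForm L x e e = fieldForm L y e e := fun e h1 h2 => by
    have h := hL.component_eq hV h1 h2
    rwa [fieldForm, fieldForm, inner_tanProj_right, inner_tanProj_right, real_inner_comm,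
      real_inner_comm e]
  have h1 := fieldForm_polarization hL.toIsSymmTensor x v w
  have h2 := fieldForm_polarization hL.toIsSymmTensor y v w
  rw [diag (v + w) (by rw [inner_add_left, hvx, hwx, add_zero])
      (by rw [inner_add_left, hvy, hwy, add_zero]),
    diag (v - w) (by rw [inner_sub_left, hvx, hwx, sub_zero])
      (by rw [inner_sub_left, hvy, hwy, sub_zero])] at h1
  linarith

theorem IsSpecialConformalKilling.exists_eq_restrict (hV : Module.finrank ℝ V = 4)
    {L : EndField V} (hL : IsSpecialConformalKilling L) :
    ∃ A : Module.End ℝ V, A.IsSymmetric ∧ L = restrict A := by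
  -- Only two orthogonality conditions are needed here; the third vector is a dummy `0`.
  choose p hpu hpv _ using fun v w : V => exists_sph_orthogonal hV v w 0
  let B : V → V → ℝ := fun v w => fieldForm L (p v w) v w
  have hB : ∀ (x : Sph V) (v w : V), ⟪v, (x : V)⟫_ℝ = 0 → ⟪w, (x : V)⟫_ℝ = 0 →
      B v w = fieldForm L x v w := fun x v w h1 h2 =>
    hL.fieldForm_eq hV (hpu v w) (hpv v w) h1 h2
  have symm : ∀ v w, B v w = B w v := fun v w => by
    rw [hB _ w v (hpv v w) (hpu v w), ← fieldForm_symm hL.toIsSymmTensor]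
  -- All three values can be compared at one point orthogonal to `v`, `v'` and `w`; this is where
  -- `dim V > 3` enters.
  have add : ∀ v v' w, B (v + v') w = B v w + B v' w := fun v v' w => by
    obtain ⟨x, h1, h2, h3⟩ := exists_sph_orthogonal hV v v' w
    rw [hB x (v + v') w (by rw [inner_add_left, h1, h2, add_zero]) h3, hB x v w h1 h3,
      hB x v' w h2 h3, fieldForm_add_left]
  have smul : ∀ (r : ℝ) v w, B (r • v) w = r * B v w := fun r v w => by
    rw [hB (p v w) (r • v) w (by rw [real_inner_smul_left, hpu, mul_zero]) (hpv v w),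
      fieldForm_smul_left]
  let Bl : V →ₗ[ℝ] V →ₗ[ℝ] ℝ := LinearMap.mk₂ ℝ B add smul
    (fun v w w' => by rw [symm, add, symm w, symm w'])
    (fun r v w => by rw [symm, smul, symm w, smul_eq_mul])
  let b := stdOrthonormalBasis ℝ V
  -- The endomorphism representing the form `Bl` through the inner product.
  let A : Module.End ℝ V := ∑ i, (Bl.flip (b i)).smulRight (b i)
  have hA : ∀ v w, ⟪A v, w⟫_ℝ = B v w := fun v w => by
    have h1 : B v w = Bl v w := rfl
    conv_rhs => rw [h1, ← b.sum_repr w, map_sum]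
    simp only [A, LinearMap.sum_apply, LinearMap.smulRight_apply, sum_inner,
      real_inner_smul_left, LinearMap.flip_apply, map_smul, smul_eq_mul,
      OrthonormalBasis.repr_apply_apply]
    exact Finset.sum_congr rfl fun i _ => mul_comm _ _
  refine ⟨A, fun v w => ?_, ?_⟩
  · rw [hA, symm, ← hA, real_inner_comm]
  · funext x
    ext v : 1
    refine ext_inner_right ℝ fun w => ?_
    have h1 : ⟪restrict A x v, w⟫_ℝ = ⟪A v, (w : V)⟫_ℝ := inner_tanProj_left x _ w
    rw [h1, hA, hB x v w (inner_tan_sph x v) (inner_tan_sph x w), fieldForm, tanProj_coe,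
      tanProj_coe]

end SinjukovEquation

end RoundSphere

end

theorem proposition11 {V : Type*} [NormedAddCommGroup V] [InnerProductSpace ℝ V]
    [FiniteDimensional ℝ V] (hV : Module.finrank ℝ V = 4) (L : RoundSphere.EndField V) :
    (RoundSphere.IsSpecialConformalKilling L ↔
      ∃ Lhat : Module.End ℝ V, Lhat.IsSymmetric ∧ L = RoundSphere.restrict Lhat) ∧
    ∀ Lhat : Module.End ℝ V, Lhat.IsSymmetric → L = RoundSphere.restrict Lhat →
      ∃ K₀ K₁ K₂ : RoundSphere.EndField V,
        (∀ t : ℝ, RoundSphere.benenti L t = t ^ 2 • K₂ + t • K₁ + K₀) ∧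
        (RoundSphere.IsStackelSystem (Submodule.span ℝ {K₀, K₁, K₂}) ↔
          ¬ ∃ μ : ℝ, 3 ≤ Module.finrank ℝ (Module.End.eigenspace Lhat μ)) := by
  refine ⟨⟨fun hL => hL.exists_eq_restrict hV, ?_⟩, ?_⟩
  · rintro ⟨A, hA, rfl⟩
    exact RoundSphere.isSpecialConformalKilling_restrict hA
  · rintro A hA rfl
    refine ⟨RoundSphere.benentiField A 0 0 1, RoundSphere.benentiField A 0 1 0,
      RoundSphere.benentiField A 1 0 0, fun t => ?_,
      RoundSphere.isStackelSystem_span_benentiField_iff hV hA⟩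
    rw [RoundSphere.benenti_restrict hV hA, RoundSphere.benentiField_eq A (t ^ 2) t 1, one_smul]
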